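/- Let $n\ge 1$. Consider the discrete-time network with $n$ neurons, state space $X=[0,1]^n$, zero external bias and weight matrix $\mathbf W=(w_{ij})\in\mathbb R^{n\times n}$, whose update map is $$\mathbf F=(F_1,\dots,F_n),\qquad F_i(x_1,\dots,x_n)=f_i\Big(\sum_{j=1}^n w_{ij}x_j\Big)\quad(1\le i\le n),$$ and whose orbits are given by $\mathbf x^{(k)}=\mathbf F(\mathbf x^{(k-1)})$, $k\ge 1$. Assume that $w_{ij}>0$ for all $i,j$ and $\frac34<\sum_{j=1}^n w_{ij}<1$ for all $i$. Let $\rho$ be the Perron–Frobenius eigenvalue (the spectral radius) of $\mathbf W$ and let $\mathbf v=(v_1,\dots,v_n)$ be the associated probability eigenvector, i.e. $\mathbf W\mathbf v=\rho\mathbf v$, $v_i\ge 0$, $\sum_i v_i=1$. Let $\varphi=(1+\sqrt5)/2$, let $\omega_k=2+\lfloor (k+1)\varphi\rfloor-\lfloor (k+2)\varphi\rfloor$ $(k\ge 0)$ be the Fibonacci word, put $\delta=\frac12+\frac14\sum_{k\ge 0}\frac{\omega_k}{2^k}$, and let the activation functions $f_i:[0,\infty)\to[0,\infty)$ be $$f_i(x)=\begin{cases}\frac1{2\rho}x+\delta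 v_i, & x\in[0,\,2(1-\delta)\rho v_i),\\[2pt] \frac1{2\rho}x+(\delta-1)v_i, & x\in[2(1-\delta)\rho v_i,\ \rho v_i],\\[2pt] \frac12 v_i+(\delta-1)v_i, & x\in[\rho v_i,\infty).\end{cases}$$ Then this is a well-defined discrete-time continuous-state Hopfield network: $X\subset[0,\infty)^n$ is compact with nonempty interior, $\mathbf F([0,\infty)^n)\subset[0,\infty)^n$, $\mathbf F(X)\subset X$, and $\mathbf F$ and the $f_i$ are piecewise smooth (their domain is covered by finitely many convex pieces, on each of which the map agrees with a $C^\infty$ map). Moreover, the network is chaotic: there is a Cantor set $C\subset X$ (a nonempty, compact, totally disconnected set without isolated points), contained in the line $\mathbb R\mathbf v$, such that 1. for every $\mathbf x^{(0)}\in C$ the $\omega$-limit set of the orbit of $\mathbf x^{(0)}$, that is, the set of all limits of subsequences $(\mathbf x^{(n_k)})_{k}$ with $n_1<n_2<\cdots$, is equal to $C$; 2. the network has sensitive dependence on initial conditions at every $\mathbf x^{(0)}\in C$: there is $\eta>0$ such that for every $\epsilon>0$ there are $\mathbf y^{(0)}\in X$ and $k\in\mathbb N$ with $\|\mathbf y^{(0)}-\mathbf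 x^{(0)}\|\le\epsilon$ and $\|\mathbf y^{(k)}-\mathbf x^{(k)}\|\ge\eta$, where $\|\cdot\|$ is the Euclidean norm. -/

import Mathlib

open Set Filter Topology

/-- `C` is a Cantor set: nonempty, compact, without isolated points, totally disconnected. -/
def IsCantorSet {E : Type*} [TopologicalSpace E] (C : Set E) : Prop :=
  C.Nonempty ∧ IsCompact C ∧ Perfect C ∧ IsTotallyDisconnected C

/-- `F` is piecewise smooth on `S`: finitely many convex pieces cover `S`, and on each of them `F`
coincides with a `C^∞` map. (In dimension one the convex pieces are the intervals.) -/
def PiecewiseSmoothOn {E E' : Type*} [NormedAddCommGroup E] [NormedSpace ℝ E]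
    [NormedAddCommGroup E'] [NormedSpace ℝ E'] (F : E → E') (S : Set E) : Prop :=
  ∃ P : Set (Set E), P.Finite ∧ S ⊆ ⋃₀ P ∧
    ∀ A ∈ P, Convex ℝ A ∧ ∃ G : E → E', ContDiff ℝ ((⊤ : ℕ∞) : WithTop ℕ∞) G ∧ EqOn F G (A ∩ S)

/-- The data `(X, W, b, f₁, …, fₙ)` of a discrete-time continuous-state network with `n` neurons.
The requirements that make it a Hopfield network are in `HopfieldData.IsNetwork`. -/
structure HopfieldData (n : ℕ) where
  /-- the state space `X` -/
  stateSpace : Set (EuclideanSpace ℝ (Fin n))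
  /-- the weight matrix `W` -/
  weight : Matrix (Fin n) (Fin n) ℝ
  /-- the external bias vector `b` -/
  bias : Fin n → ℝ
  /-- the activation functions `f_i` -/
  activation : Fin n → ℝ → ℝ

/-- The nonnegative orthant `[0,∞)ⁿ`. -/
def nonnegOrthant (n : ℕ) : Set (EuclideanSpace ℝ (Fin n)) := {x | ∀ i, 0 ≤ x i}

/-- The unit cube `[0,1]ⁿ`. -/
def unitCube (n : ℕ) : Set (EuclideanSpace ℝ (Fin n)) := {x | ∀ i, x i ∈ Icc (0 : ℝ) 1}

namespace HopfieldData

variable {n : ℕ}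

/-- The argument `∑ j, w_ij x_j - b_i` received by the `i`-th activation function. -/
def input (H : HopfieldData n) (i : Fin n) (x : EuclideanSpace ℝ (Fin n)) : ℝ :=
  ∑ j, H.weight i j * x j - H.bias i

/-- The map `F = (F₁, …, Fₙ)`, `F_i(x) = f_i (∑ j, w_ij x_j - b_i)`. -/
noncomputable def update (H : HopfieldData n) (x : EuclideanSpace ℝ (Fin n)) :
    EuclideanSpace ℝ (Fin n) :=
  WithLp.toLp 2 fun i => H.activation i (H.input i x)

/-- The network state `x^(k)` at time `k` of the orbit with initial state `x`. -/
noncomputable def orbit (H : HopfieldData n) (x : EuclideanSpace ℝ (Fin n)) (k : ℕ) :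
    EuclideanSpace ℝ (Fin n) :=
  H.update^[k] x

/-- The data define a discrete-time continuous-state Hopfield network: the state space is a compact
subset of `[0,∞)ⁿ` with nonempty interior, `F` maps `[0,∞)ⁿ` to itself and `X` to itself, and `F`
and the activation functions (on the inputs that occur) are piecewise smooth. -/
structure IsNetwork (H : HopfieldData n) : Prop where
  isCompact_stateSpace : IsCompact H.stateSpace
  interior_nonempty : (interior H.stateSpace).Nonempty
  stateSpace_subset : H.stateSpace ⊆ nonnegOrthant n
  mapsTo_orthant : MapsTo H.update (nonnegOrthant n) (nonnegOrthant n)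
  mapsTo_stateSpace : MapsTo H.update H.stateSpace H.stateSpace
  piecewiseSmooth_update : PiecewiseSmoothOn H.update (nonnegOrthant n)
  piecewiseSmooth_activation :
    ∀ i, PiecewiseSmoothOn (H.activation i) (H.input i '' nonnegOrthant n)

/-- The `ω`-limit set of the orbit of `x`: the limits of its subsequences. -/
def omegaLimitSet (H : HopfieldData n) (x : EuclideanSpace ℝ (Fin n)) :
    Set (EuclideanSpace ℝ (Fin n)) :=
  {p | ∃ m : ℕ → ℕ, StrictMono m ∧ Tendsto (fun k => H.orbit x (m k)) atTop (𝓝 p)}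

/-- Sensitive dependence on initial conditions at `x`. -/
def SensitiveAt (H : HopfieldData n) (x : EuclideanSpace ℝ (Fin n)) : Prop :=
  ∃ η : ℝ, 0 < η ∧ ∀ ε : ℝ, 0 < ε → ∃ y ∈ H.stateSpace, ∃ k : ℕ,
    ‖y - x‖ ≤ ε ∧ η ≤ ‖H.orbit y k - H.orbit x k‖

/-- `C` witnesses that the network is chaotic: it is a Cantor set in the state space, it is the
`ω`-limit set of each of its points, and there is sensitive dependence on initial conditions at each
of its points. The network is chaotic if there is such a set `C`. -/
structure IsChaoticOn (H : HopfieldData n) (C : Set (EuclideanSpace ℝ (Fin n))) : Prop where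
  isCantorSet : IsCantorSet C
  subset_stateSpace : C ⊆ H.stateSpace
  omegaLimitSet_eq : ∀ x ∈ C, H.omegaLimitSet x = C
  sensitiveAt : ∀ x ∈ C, H.SensitiveAt x

end HopfieldData

/-- The Fibonacci word `ω_i = 2 + ⌊(i+1)φ⌋ - ⌊(i+2)φ⌋`, with `φ` the golden ratio. -/
noncomputable def fibonacciWord (i : ℕ) : ℤ :=
  2 + ⌊((i : ℝ) + 1) * Real.goldenRatio⌋ - ⌊((i : ℝ) + 2) * Real.goldenRatio⌋

/-- `δ = 1/2 + (1/4) ∑_{k ≥ 0} ω_k / 2^k`. -/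
noncomputable def fibonacciDelta : ℝ :=
  1 / 2 + 1 / 4 * ∑' k : ℕ, (fibonacciWord k : ℝ) / 2 ^ k

/-- The Perron-Frobenius eigenvalue of a (positive) real square matrix: its spectral radius, the
largest modulus of a complex eigenvalue. -/
noncomputable def perronRoot {n : ℕ} (W : Matrix (Fin n) (Fin n) ℝ) : ℝ :=
  (spectralRadius ℂ (W.map (algebraMap ℝ ℂ))).toReal

/-- `v` is a probability vector and an eigenvector of `W` for the Perron-Frobenius eigenvalue. -/
structure IsPerronProbabilityVector {n : ℕ} (W : Matrix (Fin n) (Fin n) ℝ)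
    (v : EuclideanSpace ℝ (Fin n)) : Prop where
  nonneg : ∀ i, 0 ≤ v i
  sum_eq_one : ∑ i, v i = 1
  eigenvector : ∀ i, ∑ j, W i j * v j = perronRoot W * v i

/-- The piecewise affine activation function with parameters `ρ`, `δ` and `a` (`= v_i`). -/
noncomputable def piecewiseAffineActivation (ρ δ a x : ℝ) : ℝ :=
  if x < 2 * (1 - δ) * ρ * a then 1 / (2 * ρ) * x + δ * a
  else if x ≤ ρ * a then 1 / (2 * ρ) * x + (δ - 1) * a
  else 1 / 2 * a + (δ - 1) * a

/-!
On the segment `[0, 1] • v` the eigenvector equation turns the network into the contracted rotation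
`T t = t / 2 + δ mod 1` (`HopfieldData.orbit_smul`), so everything reduces to `T`. Here
`ρ > 0` and `v i > 0` by the eigenvector equation and the positivity of `W`.

The map `T` is a degenerate copy of the rotation by `θ = 2 - φ`. Let
`S y = 2 δ + 1 / 2 * ∑' k, ⌊y - (k + 1) θ⌋ / 2 ^ k`. Then `S (y + θ) = S y / 2 + ⌊y⌋ / 2 + δ` and
`S (y + 1) = S y + 1` by inspection of the series, and `S 0 = 0` because `ω k = a k - a (k + 1)` for
`a k = ⌊-(k + 1) θ⌋` (`staircaseRight_zero`). Hence `S` carries `[0, 1)` into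
`[0, 1)`, the point `1 - θ` to the discontinuity `2 (1 - δ)` of `T`, and the rotation to `T`
(`LiesOver.step`). As `θ` is irrational, `S` is strictly increasing and jumps at the dense set of
points `(k + 1) θ + m`.
To control the jumps, `S` is used together with its left-continuous version, obtained by replacing
`⌊·⌋` with `⌈·⌉ - 1`.

The Cantor set is the set of all values of the two versions over `[0, 1]`, multiplied by `v`.

* It is what is left of `[0, 1]` after deleting the jumps (`rotationAttractor_eq`), hence compact; it
  is totally disconnected as jumps occur between any two of its points.
* One-sided continuity of `S` and density of the orbits of the rotation show that every orbit in it
  accumulates at each of its points `p` along iterates different from `p` (`exists_iterate_near`).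
  This gives the `ω`-limit sets and the absence of isolated points.
* Two points over different `y < y'` with `y' - y < θ` are at some time on different sides of the
  discontinuity, as the orbit of `y` meets the interval of length `y' - y` to the left of `1 - θ`;
  one step later they are at distance at least `1 / 2` (`LiesOver.exists_half_le_of_lt`). This
  gives sensitive dependence.
-/

/-! ### The golden rotation -/

/-- The rotation number `θ = 2 - φ` of the contracted rotation. -/
noncomputable def goldenAngle : ℝ := 2 - Real.goldenRatio

lemma goldenAngle_pos : 0 < goldenAngle := by
  unfold goldenAngle; linarith [Real.goldenRatio_lt_two]

lemma goldenAngle_lt_one : goldenAngle < 1 := by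
  unfold goldenAngle; linarith [Real.one_lt_goldenRatio]

lemma goldenAngle_irrational : Irrational goldenAngle := by
  simpa [goldenAngle] using Real.goldenRatio_irrational.natCast_sub 2

/-- Every tail of every forward orbit of the rotation by `θ`, lifted to the line, meets every
interval. -/
lemma exists_rotation_mem_Ioo (y : ℝ) {a b : ℝ} (hab : a < b) (N : ℕ) :
    ∃ k : ℕ, N ≤ k ∧ ∃ m : ℤ, y + k * goldenAngle + m ∈ Ioo a b := by
  have hd : DenseRange (fun k : ℕ => k • (goldenAngle : AddCircle (1 : ℝ))) := by
    rw [← denseRange_zsmul_iff_nsmul, AddCircle.denseRange_zsmul_coe_iff]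
    simpa using goldenAngle_irrational
  set s : ℝ := y + N * goldenAngle with hs
  have ho : IsOpen ((QuotientAddGroup.mk : ℝ → AddCircle (1 : ℝ)) '' Ioo (a - s) (b - s)) :=
    QuotientAddGroup.isOpenMap_coe _ isOpen_Ioo
  obtain ⟨k, t, ht, hk⟩ := hd.exists_mem_open ho
    ((nonempty_Ioo.2 (by linarith)).image _)
  have h0 : ((t - k * goldenAngle : ℝ) : AddCircle (1 : ℝ)) = 0 := by
    rw [AddCircle.coe_sub, ← nsmul_eq_mul, AddCircle.coe_nsmul]
    exact sub_eq_zero.2 hk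
  obtain ⟨m, hm⟩ := (AddCircle.coe_eq_zero_iff 1).1 h0
  rw [zsmul_one] at hm
  refine ⟨k + N, by lia, m, ?_⟩
  have : y + (k + N : ℕ) * goldenAngle + m = s + t := by rw [hm, hs]; push_cast; ring
  rw [this]
  constructor <;> linarith [ht.1, ht.2]

/-! ### The staircase functions conjugating the rotation to the contracted rotation -/

/-- The integer part approached from the left: the largest integer strictly below `u`. -/
noncomputable def leftFloor (u : ℝ) : ℤ := ⌈u⌉ - 1

/-- The properties shared by the two integer parts `⌊·⌋` and `leftFloor`. -/
structure IsIntegerPart (g : ℝ → ℤ) : Prop where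
  le : ∀ u, (g u : ℝ) ≤ u
  sub_one_le : ∀ u, u - 1 ≤ g u
  add_one : ∀ u, g (u + 1) = g u + 1

lemma isIntegerPart_floor : IsIntegerPart (fun u => ⌊u⌋) where
  le := Int.floor_le
  sub_one_le u := (Int.sub_one_lt_floor u).le
  add_one := Int.floor_add_one

lemma isIntegerPart_leftFloor : IsIntegerPart leftFloor where
  le u := by
    have := Int.ceil_lt_add_one u
    simp only [leftFloor, Int.cast_sub, Int.cast_one]; linarith
  sub_one_le u := by
    have := Int.le_ceil u
    simp only [leftFloor, Int.cast_sub, Int.cast_one]; linarith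
  add_one u := by simp [leftFloor]

/-- The solution `S` of `S (y + θ) = S y / 2 + g y / 2 + δ` of linear growth, for an integer part
`g`. -/
noncomputable def staircase (g : ℝ → ℤ) (y : ℝ) : ℝ :=
  2 * fibonacciDelta + 1 / 2 * ∑' k : ℕ, (g (y - (k + 1) * goldenAngle) : ℝ) / 2 ^ k

lemma summable_linear_div_two_pow (c : ℝ) : Summable fun k : ℕ => (c + k) / 2 ^ k := by
  have h1 : Summable fun k : ℕ => c * (1 / 2 : ℝ) ^ k := summable_geometric_two.mul_left c
  have h2 : Summable fun k : ℕ => (k : ℝ) ^ 1 * (1 / 2 : ℝ) ^ k :=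
    summable_pow_mul_geometric_of_norm_lt_one 1 (by norm_num)
  refine (h1.add h2).congr fun k => ?_
  simp only [one_div, inv_pow, pow_one]; ring

namespace IsIntegerPart

variable {g : ℝ → ℤ}

lemma norm_term_le (hg : IsIntegerPart g) {y c : ℝ} (hy : |y| ≤ c) (k : ℕ) :
    ‖(g (y - (k + 1) * goldenAngle) : ℝ) / 2 ^ k‖ ≤ (c + 2 + k) / 2 ^ k := by
  rw [norm_div, norm_pow, Real.norm_ofNat, Real.norm_eq_abs]
  gcongr
  have h1 := hg.le (y - (k + 1) * goldenAngle)
  have h2 := hg.sub_one_le (y - (k + 1) * goldenAngle)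
  have h3 : (0 : ℝ) ≤ (k + 1) * goldenAngle := mul_nonneg (by positivity) goldenAngle_pos.le
  have h4 : (k + 1 : ℝ) * goldenAngle ≤ k + 1 :=
    mul_le_of_le_one_right (by positivity) goldenAngle_lt_one.le
  have h5 := abs_le.1 hy
  rw [abs_le]
  constructor <;> linarith [(Nat.cast_nonneg k : (0 : ℝ) ≤ k)]

lemma summable (hg : IsIntegerPart g) (y : ℝ) :
    Summable fun k : ℕ => (g (y - (k + 1) * goldenAngle) : ℝ) / 2 ^ k :=
  .of_norm_bounded (summable_linear_div_two_pow _) (hg.norm_term_le le_rfl)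

lemma staircase_add_goldenAngle (hg : IsIntegerPart g) (y : ℝ) :
    staircase g (y + goldenAngle) = staircase g y / 2 + g y / 2 + fibonacciDelta := by
  have h : ∑' k : ℕ, (g (y + goldenAngle - (k + 1) * goldenAngle) : ℝ) / 2 ^ k =
      g y + 1 / 2 * ∑' k : ℕ, (g (y - (k + 1) * goldenAngle) : ℝ) / 2 ^ k := by
    rw [(hg.summable (y + goldenAngle)).tsum_eq_zero_add, ← tsum_mul_left]
    congr 1
    · simp
    · refine tsum_congr fun k => ?_
      rw [show y + goldenAngle - ((k + 1 : ℕ) + 1) * goldenAngle = y - (k + 1) * goldenAngle by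
        push_cast; ring, pow_succ]
      field_simp
  rw [staircase, staircase, h]; ring

lemma staircase_add_one (hg : IsIntegerPart g) (y : ℝ) :
    staircase g (y + 1) = staircase g y + 1 := by
  have h : ∑' k : ℕ, (g (y + 1 - (k + 1) * goldenAngle) : ℝ) / 2 ^ k =
      ∑' k : ℕ, (g (y - (k + 1) * goldenAngle) : ℝ) / 2 ^ k + 2 := by
    have h2 := (hg.summable y).tsum_add summable_geometric_two
    rw [tsum_geometric_two] at h2
    rw [← h2]
    refine tsum_congr fun k => ?_
    rw [show y + 1 - (k + 1) * goldenAngle = y - (k + 1) * goldenAngle + 1 by ring, hg.add_one]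
    simp [add_div]
  rw [staircase, staircase, h]; ring

/-- One-sided continuity of the staircase function is inherited from its integer part. -/
lemma tendsto_staircase (hg : IsIntegerPart g) {z : ℝ} {s : Set ℝ}
    (hs : ∀ a, ∀ᶠ w in 𝓝[s] z, g (w - a) = g (z - a)) :
    Tendsto (staircase g) (𝓝[s] z) (𝓝 (staircase g z)) := by
  refine tendsto_const_nhds.add (Tendsto.const_mul _ ?_)
  refine tendsto_tsum_of_dominated_convergence
    (summable_linear_div_two_pow (|z| + 1 + 2)) (fun k => ?_) ?_
  · exact tendsto_const_nhds.congr' ((hs ((k + 1) * goldenAngle)).mono fun w hw => by simp only [hw])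
  · have : ∀ᶠ w in 𝓝 z, |w| < |z| + 1 := continuous_abs.continuousAt.eventually_lt_const (by simp)
    filter_upwards [nhdsWithin_le_nhds this] with w hw k using hg.norm_term_le hw.le k

end IsIntegerPart

/-- The right-continuous staircase function, jumping at the points `(k + 1) θ + m`. -/
noncomputable def staircaseRight : ℝ → ℝ := staircase fun u => ⌊u⌋

/-- The left-continuous version of `staircaseRight`. -/
noncomputable def staircaseLeft : ℝ → ℝ := staircase leftFloor

lemma tendsto_staircaseRight (z : ℝ) :
    Tendsto staircaseRight (𝓝[>] z) (𝓝 (staircaseRight z)) := by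
  refine isIntegerPart_floor.tendsto_staircase fun a => ?_
  have h := (tendsto_pure.1 (tendsto_floor_right_pure_floor (z - a)))
  have h2 : Tendsto (fun w => w - a) (𝓝[>] z) (𝓝[≥] (z - a)) :=
    tendsto_nhdsWithin_iff.2 ⟨((continuous_sub_right a).tendsto z).mono_left nhdsWithin_le_nhds,
      eventually_nhdsWithin_of_forall fun w (hw : z < w) => by simpa using hw.le⟩
  exact h2.eventually h

lemma tendsto_staircaseLeft (z : ℝ) :
    Tendsto staircaseLeft (𝓝[<] z) (𝓝 (staircaseLeft z)) := by
  refine isIntegerPart_leftFloor.tendsto_staircase fun a => ?_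
  have h := (tendsto_pure.1 (tendsto_ceil_left_pure_ceil (z - a)))
  have h2 : Tendsto (fun w => w - a) (𝓝[<] z) (𝓝[≤] (z - a)) :=
    tendsto_nhdsWithin_iff.2 ⟨((continuous_sub_right a).tendsto z).mono_left nhdsWithin_le_nhds,
      eventually_nhdsWithin_of_forall fun w (hw : w < z) => by simpa using hw.le⟩
  exact (h2.eventually h).mono fun w hw => by simp only [leftFloor, hw]

lemma leftFloor_le_floor (u : ℝ) : leftFloor u ≤ ⌊u⌋ := by
  have := Int.ceil_le_floor_add_one u
  unfold leftFloor; lia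

lemma floor_le_leftFloor {u u' : ℝ} (h : u < u') : ⌊u⌋ ≤ leftFloor u' := by
  have : ⌊u⌋ < ⌈u'⌉ := Int.lt_ceil.2 ((Int.floor_le u).trans_lt h)
  unfold leftFloor; lia

lemma staircaseLeft_le_staircaseRight (y : ℝ) : staircaseLeft y ≤ staircaseRight y := by
  unfold staircaseLeft staircaseRight staircase
  gcongr with k
  · exact isIntegerPart_leftFloor.summable y
  · exact isIntegerPart_floor.summable y
  · exact leftFloor_le_floor _

lemma exists_jump_mem_Ioo {y z : ℝ} (h : y < z) :
    ∃ k : ℕ, ∃ m : ℤ, (k + 1) * goldenAngle + m ∈ Ioo y z := by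
  obtain ⟨k, -, m, hm⟩ := exists_rotation_mem_Ioo goldenAngle h 0
  exact ⟨k, m, by convert hm using 1; ring⟩

/-- Strict monotonicity of both staircase functions, in one statement. -/
lemma staircaseRight_lt_staircaseLeft {y z : ℝ} (h : y < z) :
    staircaseRight y < staircaseLeft z := by
  obtain ⟨k, m, hy, hz⟩ := exists_jump_mem_Ioo h
  unfold staircaseLeft staircaseRight staircase
  gcongr 2 * fibonacciDelta + 1 / 2 * ?_
  refine (isIntegerPart_floor.summable y).tsum_lt_tsum (i := k) (fun j => ?_) ?_
    (isIntegerPart_leftFloor.summable z)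
  · gcongr
    exact floor_le_leftFloor (by linarith)
  · gcongr
    have h1 : ⌊y - (k + 1) * goldenAngle⌋ < m := Int.floor_lt.2 (by linarith)
    have h2 : m < ⌈z - (k + 1) * goldenAngle⌉ := Int.lt_ceil.2 (by linarith)
    unfold leftFloor; lia

lemma staircaseLeft_lt_staircaseRight_jump (k : ℕ) (m : ℤ) :
    staircaseLeft ((k + 1) * goldenAngle + m) < staircaseRight ((k + 1) * goldenAngle + m) := by
  unfold staircaseLeft staircaseRight staircase
  gcongr 2 * fibonacciDelta + 1 / 2 * ?_
  refine (isIntegerPart_leftFloor.summable _).tsum_lt_tsum (i := k) (fun j => ?_) ?_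
    (isIntegerPart_floor.summable _)
  · gcongr
    exact leftFloor_le_floor _
  · gcongr
    simp [leftFloor]

lemma monotone_staircaseRight : Monotone staircaseRight :=
  monotone_iff_forall_lt.2 fun _ z h =>
    (staircaseRight_lt_staircaseLeft h).le.trans (staircaseLeft_le_staircaseRight z)

lemma monotone_staircaseLeft : Monotone staircaseLeft :=
  monotone_iff_forall_lt.2 fun y _ h =>
    (staircaseLeft_le_staircaseRight y).trans (staircaseRight_lt_staircaseLeft h).le

/-- The choice of `δ` is exactly what makes the staircase pass through the origin: the Fibonacci
word consists of the differences `a k - a (k + 1)` of `a k = ⌊-(k + 1) θ⌋`, and summation by parts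
applies. -/
lemma staircaseRight_zero : staircaseRight 0 = 0 := by
  set a : ℕ → ℤ := fun k => ⌊0 - (k + 1) * goldenAngle⌋ with ha
  have hfloor (k : ℕ) : a k = ⌊((k : ℝ) + 1) * Real.goldenRatio⌋ - 2 * (k + 1) := by
    simp only [ha]
    rw [show 0 - ((k : ℝ) + 1) * goldenAngle =
      ((k : ℝ) + 1) * Real.goldenRatio - ((2 * (k + 1) : ℤ) : ℝ) by
        rw [goldenAngle]; push_cast; ring, Int.floor_sub_intCast]
  have hword (k : ℕ) : fibonacciWord k = a k - a (k + 1) := by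
    rw [hfloor, hfloor, fibonacciWord]
    push_cast
    rw [show (k : ℝ) + 1 + 1 = k + 2 by ring]
    ring
  have h0 : a 0 = -1 := by
    rw [ha, Int.floor_eq_iff]
    push_cast
    constructor <;> linarith [goldenAngle_pos, goldenAngle_lt_one]
  have hs : Summable fun k => (a k : ℝ) / 2 ^ k := isIntegerPart_floor.summable 0
  have hs1 : Summable fun k => (a (k + 1) : ℝ) / 2 ^ (k + 1) := (summable_nat_add_iff 1).2 hs
  have hA := hs.tsum_eq_zero_add
  have hw : ∑' k, (fibonacciWord k : ℝ) / 2 ^ k =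
      ∑' k, (a k : ℝ) / 2 ^ k - 2 * ∑' k, (a (k + 1) : ℝ) / 2 ^ (k + 1) := by
    rw [← tsum_mul_left, ← hs.tsum_sub (hs1.mul_left 2)]
    refine tsum_congr fun k => ?_
    rw [hword, pow_succ]
    push_cast
    field_simp
  change 2 * fibonacciDelta + 1 / 2 * ∑' k, (a k : ℝ) / 2 ^ k = 0
  rw [fibonacciDelta, hw]
  simp only [h0, Int.cast_neg, Int.cast_one, pow_zero, div_one] at hA
  linarith

lemma staircaseLeft_zero : staircaseLeft 0 = 0 := by
  refine Eq.trans ?_ staircaseRight_zero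
  unfold staircaseLeft staircaseRight staircase
  congr 2
  refine tsum_congr fun k => ?_
  -- `-(k + 1) θ` is not an integer, so both integer parts agree there.
  have hirr : Irrational (0 - ((k : ℝ) + 1) * goldenAngle) := by
    simpa using (goldenAngle_irrational.natCast_mul k.succ_ne_zero).neg
  have h1 : leftFloor (0 - (k + 1) * goldenAngle) = ⌊0 - (k + 1) * goldenAngle⌋ := by
    refine le_antisymm (leftFloor_le_floor _) ?_
    have : ⌊0 - ((k : ℝ) + 1) * goldenAngle⌋ < ⌈0 - ((k : ℝ) + 1) * goldenAngle⌉ :=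
      Int.lt_ceil.2 ((Int.floor_le _).lt_of_ne (hirr.ne_int _).symm)
    unfold leftFloor; lia
  rw [h1]

lemma staircaseRight_add_goldenAngle (y : ℝ) :
    staircaseRight (y + goldenAngle) = staircaseRight y / 2 + ⌊y⌋ / 2 + fibonacciDelta :=
  isIntegerPart_floor.staircase_add_goldenAngle y

lemma staircaseLeft_add_goldenAngle (y : ℝ) :
    staircaseLeft (y + goldenAngle) = staircaseLeft y / 2 + leftFloor y / 2 + fibonacciDelta :=
  isIntegerPart_leftFloor.staircase_add_goldenAngle y

lemma staircaseRight_add_one (y : ℝ) : staircaseRight (y + 1) = staircaseRight y + 1 :=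
  isIntegerPart_floor.staircase_add_one y

lemma staircaseLeft_add_one (y : ℝ) : staircaseLeft (y + 1) = staircaseLeft y + 1 :=
  isIntegerPart_leftFloor.staircase_add_one y

lemma staircaseRight_one : staircaseRight 1 = 1 := by
  simpa [staircaseRight_zero] using staircaseRight_add_one 0

lemma staircaseLeft_one : staircaseLeft 1 = 1 := by
  simpa [staircaseLeft_zero] using staircaseLeft_add_one 0

lemma staircaseRight_goldenAngle : staircaseRight goldenAngle = fibonacciDelta := by
  simpa [staircaseRight_zero] using staircaseRight_add_goldenAngle 0

lemma staircaseLeft_goldenAngle : staircaseLeft goldenAngle = fibonacciDelta - 1 / 2 := by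
  have h := staircaseLeft_add_goldenAngle 0
  rw [zero_add, staircaseLeft_zero] at h
  rw [h]; norm_num [leftFloor]; ring

lemma half_lt_fibonacciDelta : 1 / 2 < fibonacciDelta := by
  have := staircaseRight_lt_staircaseLeft goldenAngle_pos
  rw [staircaseRight_zero, staircaseLeft_goldenAngle] at this
  linarith

lemma fibonacciDelta_lt_one : fibonacciDelta < 1 := by
  have := staircaseRight_lt_staircaseLeft goldenAngle_lt_one
  rwa [staircaseLeft_one, staircaseRight_goldenAngle] at this

/-- The staircase takes the discontinuity `2 (1 - δ)` of the contracted rotation as its value at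
`1 - θ`, without a jump. -/
lemma staircaseRight_one_sub_goldenAngle :
    staircaseRight (1 - goldenAngle) = 2 * (1 - fibonacciDelta) := by
  have h := staircaseRight_add_goldenAngle (1 - goldenAngle)
  have h0 : ⌊1 - goldenAngle⌋ = 0 := Int.floor_eq_zero_iff.2
    ⟨by linarith [goldenAngle_lt_one], by linarith [goldenAngle_pos]⟩
  rw [sub_add_cancel, staircaseRight_one, h0] at h
  push_cast at h
  linarith

lemma staircaseLeft_one_sub_goldenAngle :
    staircaseLeft (1 - goldenAngle) = 2 * (1 - fibonacciDelta) := by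
  have h := staircaseLeft_add_goldenAngle (1 - goldenAngle)
  have h0 : leftFloor (1 - goldenAngle) = 0 := by
    rw [leftFloor, sub_eq_zero, Int.ceil_eq_iff]
    push_cast
    constructor <;> linarith [goldenAngle_lt_one, goldenAngle_pos]
  rw [sub_add_cancel, staircaseLeft_one, h0] at h
  push_cast at h
  linarith

/-! ### The contracted rotation -/

/-- The contracted rotation `t ↦ t / 2 + δ mod 1` on `[0, 1]`, with the value `δ - 1 / 2` at the
right endpoint. -/
noncomputable def contractedRotation (t : ℝ) : ℝ :=
  if t < 2 * (1 - fibonacciDelta) then t / 2 + fibonacciDelta else t / 2 + fibonacciDelta - 1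

lemma mapsTo_contractedRotation : MapsTo contractedRotation (Icc 0 1) (Icc 0 1) := by
  rintro t ⟨h0, h1⟩
  unfold contractedRotation
  split_ifs <;>
    constructor <;> linarith [half_lt_fibonacciDelta, fibonacciDelta_lt_one]

/-- The point `x` lies over the point `y` of the rotation: it is one of the two one-sided values of
the staircase at `y`. -/
def LiesOver (x y : ℝ) : Prop := x = staircaseRight y ∨ x = staircaseLeft y

namespace LiesOver

variable {x y x' y' : ℝ}

lemma left_le (h : LiesOver x y) : staircaseLeft y ≤ x := by
  rcases h with rfl | rfl
  exacts [staircaseLeft_le_staircaseRight y, le_rfl]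

lemma le_right (h : LiesOver x y) : x ≤ staircaseRight y := by
  rcases h with rfl | rfl
  exacts [le_rfl, staircaseLeft_le_staircaseRight y]

lemma lt (h : LiesOver x y) (h' : LiesOver x' y') (hy : y < y') : x < x' :=
  (h.le_right.trans_lt (staircaseRight_lt_staircaseLeft hy)).trans_le h'.left_le

lemma mem_Icc (h : LiesOver x y) (hy : y ∈ Icc (0 : ℝ) 1) : x ∈ Icc (0 : ℝ) 1 :=
  ⟨staircaseLeft_zero.symm.le.trans ((monotone_staircaseLeft hy.1).trans h.left_le),
    (h.le_right.trans (monotone_staircaseRight hy.2)).trans staircaseRight_one.le⟩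

lemma eq_of_zero (h : LiesOver x 0) : x = 0 := by
  simpa [LiesOver, staircaseRight_zero, staircaseLeft_zero] using h

lemma eq_of_one (h : LiesOver x 1) : x = 1 := by
  simpa [LiesOver, staircaseRight_one, staircaseLeft_one] using h

lemma eq_of_one_sub_goldenAngle (h : LiesOver x (1 - goldenAngle)) :
    x = 2 * (1 - fibonacciDelta) := by
  simpa [LiesOver, staircaseRight_one_sub_goldenAngle, staircaseLeft_one_sub_goldenAngle] using h

lemma sub_one (h : LiesOver x y) : LiesOver (x - 1) (y - 1) := by
  have h1 := staircaseRight_add_one (y - 1)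
  have h2 := staircaseLeft_add_one (y - 1)
  rw [sub_add_cancel] at h1 h2
  rcases h with rfl | rfl
  · left; linarith
  · right; linarith

lemma half_add (h : LiesOver x y) (hy : y ∈ Ioo (0 : ℝ) 1) :
    LiesOver (x / 2 + fibonacciDelta) (y + goldenAngle) := by
  have h1 := staircaseRight_add_goldenAngle y
  have h2 := staircaseLeft_add_goldenAngle y
  rw [Int.floor_eq_zero_iff.2 ⟨hy.1.le, hy.2⟩] at h1
  have h0 : leftFloor y = 0 := by
    rw [leftFloor, sub_eq_zero, Int.ceil_eq_iff]
    push_cast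
    constructor <;> linarith [hy.1, hy.2]
  rw [h0] at h2
  push_cast at h1 h2
  rcases h with rfl | rfl
  · left; linarith
  · right; linarith

/-- The staircase semiconjugates the rotation to the contracted rotation. -/
lemma step (h : LiesOver x y) (hy : y ∈ Icc (0 : ℝ) 1) :
    ∃ y' ∈ Icc (0 : ℝ) 1, (∃ m : ℤ, y' = y + goldenAngle + m) ∧
      LiesOver (contractedRotation x) y' := by
  have hθ : goldenAngle ∈ Icc (0 : ℝ) 1 := ⟨goldenAngle_pos.le, goldenAngle_lt_one.le⟩
  have hδ := half_lt_fibonacciDelta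
  have hδ' := fibonacciDelta_lt_one
  rcases hy.1.eq_or_lt with rfl | hy0
  · refine ⟨goldenAngle, hθ, ⟨0, by simp⟩, .inl ?_⟩
    rw [h.eq_of_zero, staircaseRight_goldenAngle, contractedRotation, if_pos (by linarith)]
    ring
  rcases hy.2.eq_or_lt with rfl | hy1
  · refine ⟨goldenAngle, hθ, ⟨-1, by push_cast; ring⟩, .inr ?_⟩
    rw [h.eq_of_one, staircaseLeft_goldenAngle, contractedRotation, if_neg (by linarith)]
    ring
  have hc : LiesOver (2 * (1 - fibonacciDelta)) (1 - goldenAngle) :=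
    .inl staircaseRight_one_sub_goldenAngle.symm
  have h' := h.half_add ⟨hy0, hy1⟩
  rcases lt_or_ge y (1 - goldenAngle) with hlt | hge
  · refine ⟨y + goldenAngle, ⟨by linarith [hθ.1], by linarith⟩, ⟨0, by simp⟩, ?_⟩
    rwa [contractedRotation, if_pos (h.lt hc hlt)]
  · refine ⟨y + goldenAngle - 1, ⟨by linarith, by linarith [hθ.2]⟩, ⟨-1, by push_cast; ring⟩, ?_⟩
    have hx : 2 * (1 - fibonacciDelta) ≤ x := by
      rcases hge.eq_or_lt with rfl | hgt
      · exact h.eq_of_one_sub_goldenAngle.ge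
      · exact (hc.lt h hgt).le
    rw [contractedRotation, if_neg hx.not_gt]
    exact h'.sub_one

lemma exists_iterate (h : LiesOver x y) (hy : y ∈ Icc (0 : ℝ) 1) (k : ℕ) :
    ∃ y' ∈ Icc (0 : ℝ) 1, (∃ m : ℤ, y' = y + k * goldenAngle + m) ∧
      LiesOver (contractedRotation^[k] x) y' := by
  induction k with
  | zero => exact ⟨y, hy, ⟨0, by simp⟩, h⟩
  | succ k ih =>
    obtain ⟨y₁, hy₁, ⟨m₁, hm₁⟩, h₁⟩ := ih
    obtain ⟨y₂, hy₂, ⟨m₂, hm₂⟩, h₂⟩ := h₁.step hy₁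
    refine ⟨y₂, hy₂, ⟨m₁ + m₂, by rw [hm₂, hm₁]; push_cast; ring⟩, ?_⟩
    rwa [Function.iterate_succ_apply']

lemma iterate (h : LiesOver x y) (hy : y ∈ Icc (0 : ℝ) 1) {k : ℕ} {m : ℤ}
    (hk : y + k * goldenAngle + m ∈ Ioo (0 : ℝ) 1) :
    LiesOver (contractedRotation^[k] x) (y + k * goldenAngle + m) := by
  obtain ⟨y', hy', ⟨m', hm'⟩, h'⟩ := h.exists_iterate hy k
  have h1 : ((m' - m : ℤ) : ℝ) < 1 := by push_cast; linarith [hy'.2, hk.1]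
  have h2 : ((-1 : ℤ) : ℝ) < (m' - m : ℤ) := by push_cast; linarith [hy'.1, hk.2]
  have : m' = m := by
    have h1' : m' - m < 1 := by exact_mod_cast h1
    have h2' : -1 < m' - m := by exact_mod_cast h2
    lia
  rwa [hm', this] at h'

/-- Points lying over a suitable one-sided punctured neighbourhood of `z` are close to, but distinct
from, a given point lying over `z`. -/
lemma exists_Ioo (h : LiesOver x y) (hy : y ∈ Icc (0 : ℝ) 1) {ε : ℝ} (hε : 0 < ε) :
    ∃ a b : ℝ, 0 ≤ a ∧ a < b ∧ b ≤ 1 ∧ ∀ w ∈ Ioo a b, (w ≠ y ∧ |w - y| < goldenAngle) ∧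
      ∀ x', LiesOver x' w → x' ≠ x ∧ |x' - x| < ε := by
  have hθ := goldenAngle_pos
  have hcase : (x = staircaseRight y ∧ y < 1) ∨ (x = staircaseLeft y ∧ 0 < y) := by
    rcases h with h | h
    · rcases hy.2.eq_or_lt with rfl | h1
      · exact .inr ⟨by rw [h, staircaseRight_one, staircaseLeft_one], one_pos⟩
      · exact .inl ⟨h, h1⟩
    · rcases hy.1.eq_or_lt with rfl | h0
      · exact .inl ⟨by rw [h, staircaseRight_zero, staircaseLeft_zero], one_pos⟩
      · exact .inr ⟨h, h0⟩
  rcases hcase with ⟨rfl, h1⟩ | ⟨rfl, h0⟩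
  · have hev := (tendsto_staircaseRight y).eventually
      (eventually_lt_nhds (lt_add_of_pos_right _ hε))
    obtain ⟨u, hu, hsub⟩ := (mem_nhdsGT_iff_exists_Ioo_subset' h1).1 hev
    have hu : y < u := hu
    refine ⟨y, min u (min 1 (y + goldenAngle)), hy.1, by simp [hu, h1, hθ], by simp, ?_⟩
    rintro w ⟨hyw, hw⟩
    simp only [lt_min_iff] at hw
    refine ⟨⟨hyw.ne', by rw [abs_of_pos] <;> linarith⟩, fun x' hx' => ?_⟩
    have hlt : staircaseRight y < x' := h.lt hx' hyw
    have hlt' : x' < staircaseRight y + ε := hx'.le_right.trans_lt (hsub ⟨hyw, hw.1⟩)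
    exact ⟨hlt.ne', by rw [abs_of_pos] <;> linarith⟩
  · have hev := (tendsto_staircaseLeft y).eventually
      (eventually_gt_nhds (sub_lt_self _ hε))
    obtain ⟨u, hu, hsub⟩ := (mem_nhdsLT_iff_exists_Ioo_subset' h0).1 hev
    have hu : u < y := hu
    refine ⟨max u (max 0 (y - goldenAngle)), y, by simp, by simp [hu, h0, hθ], hy.2, ?_⟩
    rintro w ⟨hw, hyw⟩
    simp only [max_lt_iff] at hw
    refine ⟨⟨hyw.ne, by rw [abs_of_neg] <;> linarith⟩, fun x' hx' => ?_⟩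
    have hlt : x' < staircaseLeft y := hx'.lt h hyw
    have hlt' : staircaseLeft y - ε < x' := (hsub ⟨hw.1, hyw⟩).trans_le hx'.left_le
    exact ⟨hlt.ne, by rw [abs_of_neg] <;> linarith⟩

/-- Two points over different, nearby points of the rotation are eventually separated by the
discontinuity, and the next step then puts them at distance at least `1 / 2`. -/
lemma exists_half_le_of_lt (h : LiesOver x y) (hy : y ∈ Icc (0 : ℝ) 1) (h' : LiesOver x' y')
    (hy' : y' ∈ Icc (0 : ℝ) 1) (hlt : y < y') (hθ : y' - y < goldenAngle) :
    ∃ k : ℕ, 1 / 2 ≤ |contractedRotation^[k] x' - contractedRotation^[k] x| := by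
  -- Some iterate of `y` is so close to `1 - θ`, on its left, that the same iterate of `y'` is on
  -- its right.
  obtain ⟨k, -, m, hl, hr⟩ := exists_rotation_mem_Ioo y
    (show max 0 (1 - goldenAngle - (y' - y)) < 1 - goldenAngle from
      max_lt (by linarith [goldenAngle_lt_one]) (by linarith)) 0
  rw [max_lt_iff] at hl
  have hk := h.iterate hy (k := k) (m := m) ⟨hl.1, by linarith [goldenAngle_pos]⟩
  have hk' := h'.iterate hy' (k := k) (m := m) ⟨by linarith, by linarith⟩
  have hc : LiesOver (2 * (1 - fibonacciDelta)) (1 - goldenAngle) :=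
    .inl staircaseRight_one_sub_goldenAngle.symm
  have h1 := hk.lt hc hr
  have h2 := hc.lt hk' (by linarith)
  have hx := hk.mem_Icc ⟨hl.1.le, by linarith [goldenAngle_pos]⟩
  have hx' := hk'.mem_Icc ⟨by linarith, by linarith⟩
  refine ⟨k + 1, ?_⟩
  rw [Function.iterate_succ_apply', Function.iterate_succ_apply', contractedRotation,
    contractedRotation, if_neg h2.le.not_gt, if_pos h1, abs_sub_comm, le_abs]
  left
  linarith [hx.1, hx'.2]

end LiesOver

/-! ### The attractor of the contracted rotation -/

/-- The closure of the range of the staircase on a fundamental domain of the rotation. -/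
def rotationAttractor : Set ℝ := {x | ∃ y ∈ Icc (0 : ℝ) 1, LiesOver x y}

lemma rotationAttractor_subset : rotationAttractor ⊆ Icc 0 1 :=
  fun _ ⟨_, hy, h⟩ => h.mem_Icc hy

lemma zero_mem_rotationAttractor : (0 : ℝ) ∈ rotationAttractor :=
  ⟨0, by simp, .inl staircaseRight_zero.symm⟩

lemma iterate_mem_rotationAttractor {x : ℝ} (hx : x ∈ rotationAttractor) (k : ℕ) :
    contractedRotation^[k] x ∈ rotationAttractor := by
  obtain ⟨y, hy, h⟩ := hx
  obtain ⟨y', hy', -, h'⟩ := h.exists_iterate hy k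
  exact ⟨y', hy', h'⟩

lemma LiesOver.notMem_jump {x y : ℝ} (h : LiesOver x y) (w : ℝ) :
    x ≤ staircaseLeft w ∨ staircaseRight w ≤ x := by
  rcases lt_trichotomy y w with hlt | rfl | hgt
  · exact .inl (h.le_right.trans (staircaseRight_lt_staircaseLeft hlt).le)
  · exact h.symm.imp le_of_eq ge_of_eq
  · exact .inr ((staircaseRight_lt_staircaseLeft hgt).le.trans h.left_le)

/-- The attractor is what is left of `[0, 1]` when all jumps of the staircase are removed. -/
lemma rotationAttractor_eq : rotationAttractor =
    Icc 0 1 ∩ ⋂ w, (Iic (staircaseLeft w) ∪ Ici (staircaseRight w)) := by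
  refine Subset.antisymm (fun x hx => ⟨rotationAttractor_subset hx, mem_iInter.2 fun w => ?_⟩) ?_
  · obtain ⟨y, -, h⟩ := hx
    exact h.notMem_jump w
  rintro x ⟨hx, hjump⟩
  set s : Set ℝ := {y | y ∈ Icc (0 : ℝ) 1 ∧ staircaseRight y ≤ x} with hs
  have h0s : (0 : ℝ) ∈ s := ⟨by simp, staircaseRight_zero.le.trans hx.1⟩
  have hbdd : BddAbove s := ⟨1, fun y hy => hy.1.2⟩
  set y := sSup s with hy
  have hy0 : 0 ≤ y := le_csSup hbdd h0s
  have hy1 : y ≤ 1 := csSup_le ⟨0, h0s⟩ fun z hz => hz.1.2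
  have hle : staircaseLeft y ≤ x := by
    refine le_of_tendsto (tendsto_staircaseLeft y) ?_
    filter_upwards [self_mem_nhdsWithin] with w hw
    obtain ⟨z, hz, hwz⟩ := exists_lt_of_lt_csSup ⟨0, h0s⟩ hw
    exact (monotone_staircaseLeft hwz.le).trans
      ((staircaseLeft_le_staircaseRight z).trans hz.2)
  have hge : x ≤ staircaseRight y := by
    rcases hy1.eq_or_lt with h1 | h1
    · rw [h1, staircaseRight_one]; exact hx.2
    · refine ge_of_tendsto (tendsto_staircaseRight y) ?_
      filter_upwards [Ioo_mem_nhdsGT h1] with w hw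
      by_contra! hlt
      exact hw.1.not_ge (le_csSup hbdd ⟨⟨hy0.trans hw.1.le, hw.2.le⟩, hlt.le⟩)
  refine ⟨y, ⟨hy0, hy1⟩, ?_⟩
  rcases mem_iInter.1 hjump y with h | h
  · exact .inr (le_antisymm h hle)
  · exact .inl (le_antisymm hge h)

lemma isCompact_rotationAttractor : IsCompact rotationAttractor := by
  rw [rotationAttractor_eq]
  exact isCompact_Icc.inter_right (isClosed_iInter fun w => isClosed_Iic.union isClosed_Ici)

/-- Jumps of the staircase separate any two points of the attractor. -/
lemma isTotallyDisconnected_rotationAttractor : IsTotallyDisconnected rotationAttractor := by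
  have key : ∀ x ∈ rotationAttractor, ∀ x' ∈ rotationAttractor, x < x' →
      ∃ t ∈ Icc x x', t ∉ rotationAttractor := by
    rintro x ⟨y, -, h⟩ x' ⟨y', -, h'⟩ hlt
    obtain ⟨w, hw, hxw, hwx⟩ : ∃ w, staircaseLeft w < staircaseRight w ∧
        x ≤ staircaseLeft w ∧ staircaseRight w ≤ x' := by
      rcases lt_trichotomy y y' with hyy | rfl | hyy
      · obtain ⟨k, m, hm⟩ := exists_jump_mem_Ioo hyy
        exact ⟨_, staircaseLeft_lt_staircaseRight_jump k m,
          h.le_right.trans (staircaseRight_lt_staircaseLeft hm.1).le,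
          (staircaseRight_lt_staircaseLeft hm.2).le.trans h'.left_le⟩
      · have h1 := h.left_le
        have h2 := h'.le_right
        refine ⟨y, by linarith, ?_⟩
        rcases h with rfl | rfl
        · exact absurd h2 hlt.not_ge
        · rcases h' with rfl | rfl
          exacts [⟨le_rfl, le_rfl⟩, absurd hlt (lt_irrefl _)]
      · exact absurd (h'.lt h hyy) hlt.not_gt
    obtain ⟨t, ht1, ht2⟩ := exists_between hw
    refine ⟨t, ⟨hxw.trans ht1.le, ht2.le.trans hwx⟩, fun ⟨z, _, hz⟩ => ?_⟩
    rcases hz.notMem_jump w with h3 | h3 <;> linarith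
  intro s hs hpre x hx x' hx'
  by_contra hne
  rcases lt_or_gt_of_ne hne with hlt | hlt
  · obtain ⟨t, ht, hts⟩ := key x (hs hx) x' (hs hx') hlt
    exact hts (hs (hpre.ordConnected.out hx hx' ht))
  · obtain ⟨t, ht, hts⟩ := key x' (hs hx') x (hs hx) hlt
    exact hts (hs (hpre.ordConnected.out hx' hx ht))

/-- Every orbit in the attractor returns arbitrarily late and arbitrarily closely to every point
`p` of the attractor, at iterates different from `p`. -/
lemma exists_iterate_near {x p : ℝ} (hx : x ∈ rotationAttractor) (hp : p ∈ rotationAttractor)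
    {ε : ℝ} (hε : 0 < ε) (N : ℕ) :
    ∃ k ≥ N, contractedRotation^[k] x ≠ p ∧ |contractedRotation^[k] x - p| < ε := by
  obtain ⟨y, hy, h⟩ := hx
  obtain ⟨z, hz, hpz⟩ := hp
  obtain ⟨a, b, ha, hab, hb, hnear⟩ := hpz.exists_Ioo hz hε
  obtain ⟨k, hk, m, hm⟩ := exists_rotation_mem_Ioo y hab N
  exact ⟨k, hk, (hnear _ hm).2 _
    (h.iterate hy ⟨ha.trans_lt hm.1, hm.2.trans_le hb⟩)⟩

lemma preperfect_rotationAttractor : Preperfect rotationAttractor := by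
  refine preperfect_iff_nhds.2 fun p hp U hU => ?_
  obtain ⟨ε, hε, hball⟩ := Metric.mem_nhds_iff.1 hU
  obtain ⟨k, -, hne, hlt⟩ := exists_iterate_near zero_mem_rotationAttractor hp hε 0
  exact ⟨_, ⟨hball hlt, iterate_mem_rotationAttractor zero_mem_rotationAttractor k⟩, hne⟩

lemma exists_subseq_tendsto {x p : ℝ} (hx : x ∈ rotationAttractor) (hp : p ∈ rotationAttractor) :
    ∃ m : ℕ → ℕ, StrictMono m ∧ Tendsto (fun k => contractedRotation^[m k] x) atTop (𝓝 p) := by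
  have : MapClusterPt p atTop fun k => contractedRotation^[k] x := by
    refine Metric.nhds_basis_ball.mapClusterPt_iff_frequently.2 fun ε hε => ?_
    refine frequently_atTop.2 fun N => ?_
    obtain ⟨k, hk, -, hlt⟩ := exists_iterate_near hx hp hε N
    exact ⟨k, hk, hlt⟩
  exact this.tendsto_subseq

lemma exists_half_le_iterate_sub {x : ℝ} (hx : x ∈ rotationAttractor) {ε : ℝ} (hε : 0 < ε) :
    ∃ x' ∈ Icc (0 : ℝ) 1, |x' - x| < ε ∧
      ∃ k : ℕ, 1 / 2 ≤ |contractedRotation^[k] x' - contractedRotation^[k] x| := by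
  obtain ⟨y, hy, h⟩ := hx
  obtain ⟨a, b, ha, hab, hb, hnear⟩ := h.exists_Ioo hy hε
  obtain ⟨w, hw⟩ := exists_between hab
  obtain ⟨⟨hwy, hwθ⟩, hw'⟩ := hnear w hw
  have hwI : w ∈ Icc (0 : ℝ) 1 := ⟨ha.trans hw.1.le, hw.2.le.trans hb⟩
  have hover : LiesOver (staircaseRight w) w := .inl rfl
  refine ⟨_, hover.mem_Icc hwI, (hw' _ hover).2, ?_⟩
  rcases lt_or_gt_of_ne hwy with hlt | hlt
  · obtain ⟨k, hk⟩ := hover.exists_half_le_of_lt hwI h hy hlt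
      (by rw [abs_sub_comm] at hwθ; exact (le_abs_self _).trans_lt hwθ)
    exact ⟨k, by rwa [abs_sub_comm]⟩
  · exact h.exists_half_le_of_lt hy hover hwI hlt ((le_abs_self _).trans_lt hwθ)

/-! ### Piecewise smoothness -/

lemma PiecewiseSmoothOn.mono {E E' : Type*} [NormedAddCommGroup E] [NormedSpace ℝ E]
    [NormedAddCommGroup E'] [NormedSpace ℝ E'] {F : E → E'} {S T : Set E}
    (h : PiecewiseSmoothOn F T) (hST : S ⊆ T) : PiecewiseSmoothOn F S := by
  obtain ⟨P, hP, hcov, hA⟩ := h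
  refine ⟨P, hP, hST.trans hcov, fun A hAP => ?_⟩
  obtain ⟨hconv, G, hG, heq⟩ := hA A hAP
  exact ⟨hconv, G, hG, heq.mono (inter_subset_inter_right A hST)⟩

/-- A map into Euclidean space is piecewise smooth if its coordinates are piecewise smooth functions
of linear forms: intersect the preimages of the pieces of the coordinates. -/
lemma piecewiseSmoothOn_toLp {ι E : Type*} [Fintype ι] [NormedAddCommGroup E] [NormedSpace ℝ E]
    {f : ι → ℝ → ℝ} {L : ι → E →L[ℝ] ℝ} {T : ι → Set ℝ} {S : Set E}
    (hf : ∀ i, PiecewiseSmoothOn (f i) (T i)) (hL : ∀ i, MapsTo (L i) S (T i)) :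
    PiecewiseSmoothOn (fun x => (WithLp.toLp 2 fun i => f i (L i x) : EuclideanSpace ℝ ι)) S := by
  choose P hP hcov hpiece using hf
  refine ⟨(fun A : ι → Set ℝ => ⋂ i, L i ⁻¹' A i) '' univ.pi P,
    (Set.Finite.pi fun i => hP i).image _, fun x hx => ?_, ?_⟩
  · choose A hA hxA using fun i => mem_sUnion.1 (hcov i (hL i hx))
    exact mem_sUnion.2 ⟨_, mem_image_of_mem _ (mem_univ_pi.2 hA), mem_iInter.2 hxA⟩
  · rintro _ ⟨A, hA, rfl⟩
    rw [mem_univ_pi] at hA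
    refine ⟨convex_iInter fun i => (hpiece i _ (hA i)).1.linear_preimage (L i).toLinearMap, ?_⟩
    choose G hG heq using fun i => (hpiece i _ (hA i)).2
    refine ⟨fun x => WithLp.toLp 2 fun i => G i (L i x),
      contDiff_euclidean.2 fun i => (hG i).comp (L i).contDiff, fun x hx => ?_⟩
    have hi (i : ι) : f i (L i x) = G i (L i x) := heq i ⟨mem_iInter.1 hx.1 i, hL i hx.2⟩
    simp only [hi]

lemma piecewiseSmoothOn_piecewiseAffineActivation (ρ δ a : ℝ) (S : Set ℝ) :
    PiecewiseSmoothOn (piecewiseAffineActivation ρ δ a) S := by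
  refine ⟨{Iio (2 * (1 - δ) * ρ * a), Ici (2 * (1 - δ) * ρ * a) ∩ Iic (ρ * a),
    Ici (2 * (1 - δ) * ρ * a) ∩ Ioi (ρ * a)}, by simp, fun x _ => ?_, ?_⟩
  · simp only [sUnion_insert, sUnion_singleton, ← inter_union_distrib_left, Iic_union_Ioi,
      inter_univ, Iio_union_Ici, mem_univ]
  · simp only [mem_insert_iff, mem_singleton_iff, forall_eq_or_imp, forall_eq]
    refine ⟨⟨convex_Iio _, fun x => 1 / (2 * ρ) * x + δ * a, by fun_prop, ?_⟩,
      ⟨(convex_Ici _).inter (convex_Iic _), fun x => 1 / (2 * ρ) * x + (δ - 1) * a, by fun_prop,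
        ?_⟩,
      ⟨(convex_Ici _).inter (convex_Ioi _), fun x => 1 / 2 * a + (δ - 1) * a, by fun_prop, ?_⟩⟩
    · rintro x ⟨hx, -⟩
      exact if_pos hx
    · rintro x ⟨⟨hx, hx'⟩, -⟩
      exact (if_neg (not_lt.2 hx)).trans (if_pos hx')
    · rintro x ⟨⟨hx, hx'⟩, -⟩
      exact (if_neg (not_lt.2 hx)).trans (if_neg (not_le.2 hx'))

/-! ### The activation functions -/

lemma piecewiseAffineActivation_mem_Icc {ρ a x : ℝ} (hρ : 0 < ρ) (ha : 0 < a) (hx : 0 ≤ x) :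
    piecewiseAffineActivation ρ fibonacciDelta a x ∈ Icc 0 a := by
  have hδ := half_lt_fibonacciDelta
  have hδ' := fibonacciDelta_lt_one
  -- In units of `ρ * a` for the input and `a` for the output, `ρ` and `a` disappear.
  obtain ⟨t, rfl⟩ : ∃ t, x = t * (ρ * a) := ⟨x / (ρ * a), by field_simp⟩
  have hρa : 0 < ρ * a := mul_pos hρ ha
  have ht : 0 ≤ t := nonneg_of_mul_nonneg_left hx hρa
  have h1 : 1 / (2 * ρ) * (t * (ρ * a)) = t / 2 * a := by field_simp
  have h2 : 2 * (1 - fibonacciDelta) * ρ * a = 2 * (1 - fibonacciDelta) * (ρ * a) := by ring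
  rw [piecewiseAffineActivation, h1, h2]
  have key : ∀ s : ℝ, 0 ≤ s → s ≤ 1 → s * a ∈ Icc 0 a := fun s h0 h1 =>
    ⟨mul_nonneg h0 ha.le, mul_le_of_le_one_left ha.le h1⟩
  split_ifs with h h'
  · rw [← add_mul]
    have := lt_of_mul_lt_mul_right h hρa.le
    exact key _ (by linarith) (by linarith)
  · rw [← add_mul]
    have h3 := le_of_mul_le_mul_right (not_lt.1 h) hρa
    have h4 : t ≤ 1 := le_of_mul_le_mul_right (by rwa [one_mul]) hρa
    exact key _ (by linarith) (by linarith)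
  · rw [← add_mul]
    exact key _ (by linarith) (by linarith)

lemma piecewiseAffineActivation_mul {ρ a t : ℝ} (hρ : 0 < ρ) (ha : 0 < a) (ht : t ≤ 1) :
    piecewiseAffineActivation ρ fibonacciDelta a (t * (ρ * a)) = contractedRotation t * a := by
  have hρa : 0 < ρ * a := mul_pos hρ ha
  have h1 : 1 / (2 * ρ) * (t * (ρ * a)) = t / 2 * a := by field_simp
  have h2 : 2 * (1 - fibonacciDelta) * ρ * a = 2 * (1 - fibonacciDelta) * (ρ * a) := by ring
  rw [piecewiseAffineActivation, contractedRotation, h1, h2,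
    if_pos (show t * (ρ * a) ≤ ρ * a from mul_le_of_le_one_left hρa.le ht)]
  simp only [mul_lt_mul_iff_left₀ hρa]
  split_ifs <;> ring

namespace IsPerronProbabilityVector

variable {n : ℕ} {W : Matrix (Fin n) (Fin n) ℝ} {v : EuclideanSpace ℝ (Fin n)}

lemma le_one (hv : IsPerronProbabilityVector W v) (i : Fin n) : v i ≤ 1 :=
  hv.sum_eq_one ▸ Finset.single_le_sum (fun j _ => hv.nonneg j) (Finset.mem_univ i)

lemma perronRoot_mul_pos (hv : IsPerronProbabilityVector W v) (hW : ∀ i j, 0 < W i j)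
    (i : Fin n) : 0 < perronRoot W * v i := by
  rw [← hv.eigenvector]
  obtain ⟨j, hj⟩ : ∃ j, 0 < v j := by
    by_contra! h
    linarith [hv.sum_eq_one, Finset.sum_nonpos fun j (_ : j ∈ Finset.univ) => h j]
  exact Finset.sum_pos' (fun j _ => mul_nonneg (hW i j).le (hv.nonneg j))
    ⟨j, Finset.mem_univ j, mul_pos (hW i j) hj⟩

lemma perronRoot_pos (hv : IsPerronProbabilityVector W v) (hW : ∀ i j, 0 < W i j)
    (i : Fin n) : 0 < perronRoot W :=
  pos_of_mul_pos_left (hv.perronRoot_mul_pos hW i) (hv.nonneg i)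

lemma pos (hv : IsPerronProbabilityVector W v) (hW : ∀ i j, 0 < W i j) (i : Fin n) : 0 < v i :=
  pos_of_mul_pos_right (hv.perronRoot_mul_pos hW i) ENNReal.toReal_nonneg

lemma norm_pos (hv : IsPerronProbabilityVector W v) : 0 < ‖v‖ := by
  rw [norm_pos_iff]
  rintro rfl
  simpa using hv.sum_eq_one

end IsPerronProbabilityVector

/-! ### The network -/

lemma isCompact_unitCube (n : ℕ) : IsCompact (unitCube n) := by
  have : unitCube n = (EuclideanSpace.equiv (Fin n) ℝ).toHomeomorph ⁻¹'
      (univ.pi fun _ => Icc (0 : ℝ) 1) := by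
    ext x; simp [unitCube, Pi.le_def, forall_and]
  rw [this, Homeomorph.isCompact_preimage]
  exact isCompact_univ_pi fun _ => isCompact_Icc

lemma interior_unitCube_nonempty (n : ℕ) : (interior (unitCube n)).Nonempty := by
  have hopen : IsOpen {x : EuclideanSpace ℝ (Fin n) | ∀ i, x i ∈ Ioo (0 : ℝ) 1} := by
    have : {x : EuclideanSpace ℝ (Fin n) | ∀ i, x i ∈ Ioo (0 : ℝ) 1} =
        ⋂ i, EuclideanSpace.proj (𝕜 := ℝ) i ⁻¹' Ioo (0 : ℝ) 1 := by
      ext x; simp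
    rw [this]
    exact isOpen_iInter_of_finite fun i => isOpen_Ioo.preimage (EuclideanSpace.proj i).continuous
  refine ⟨WithLp.toLp 2 fun _ => 1 / 2, interior_maximal ?_ hopen fun i => ?_⟩
  · exact fun x hx i => Ioo_subset_Icc_self (hx i)
  · norm_num

namespace HopfieldData

variable {n : ℕ} {H : HopfieldData n} {v : EuclideanSpace ℝ (Fin n)}

/-- The input of the `i`-th neuron, as a linear form. -/
noncomputable def inputForm (H : HopfieldData n) (i : Fin n) : EuclideanSpace ℝ (Fin n) →L[ℝ] ℝ :=
  ∑ j, H.weight i j • EuclideanSpace.proj j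

lemma input_eq_inputForm (hb : ∀ i, H.bias i = 0) (i : Fin n) (x : EuclideanSpace ℝ (Fin n)) :
    H.input i x = H.inputForm i x := by
  simp [input, inputForm, hb]

lemma input_nonneg (hb : ∀ i, H.bias i = 0) (hWpos : ∀ i j, 0 < H.weight i j) (i : Fin n)
    {x : EuclideanSpace ℝ (Fin n)} (hx : x ∈ nonnegOrthant n) : 0 ≤ H.input i x := by
  rw [input, hb, sub_zero]
  exact Finset.sum_nonneg fun j _ => mul_nonneg (hWpos i j).le (hx j)

lemma isNetwork_of_piecewiseAffineActivation
    (hX : H.stateSpace = unitCube n) (hb : ∀ i, H.bias i = 0)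
    (hWpos : ∀ i j, 0 < H.weight i j) (hv : IsPerronProbabilityVector H.weight v)
    (hf : ∀ i, ∀ x : ℝ, 0 ≤ x → H.activation i x =
      piecewiseAffineActivation (perronRoot H.weight) fibonacciDelta (v i) x) :
    H.IsNetwork := by
  have hsub : unitCube n ⊆ nonnegOrthant n := fun x hx i => (hx i).1
  have hupd : ∀ x ∈ nonnegOrthant n, H.update x ∈ unitCube n := fun x hx i => by
    have h := piecewiseAffineActivation_mem_Icc (hv.perronRoot_pos hWpos i) (hv.pos hWpos i)
      (input_nonneg hb hWpos i hx)
    rw [← hf i _ (input_nonneg hb hWpos i hx)] at h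
    exact ⟨h.1, h.2.trans (hv.le_one i)⟩
  have hact : ∀ i, PiecewiseSmoothOn (H.activation i) (Ici 0) := fun i => by
    obtain ⟨P, hP, hcov, hA⟩ := piecewiseSmoothOn_piecewiseAffineActivation
      (perronRoot H.weight) fibonacciDelta (v i) (Ici 0)
    refine ⟨P, hP, hcov, fun A hAP => ?_⟩
    obtain ⟨hconv, G, hG, heq⟩ := hA A hAP
    exact ⟨hconv, G, hG, fun x hx => (hf i x hx.2).trans (heq hx)⟩
  have himage : ∀ i, MapsTo (H.inputForm i) (nonnegOrthant n) (Ici 0) := fun i x hx => by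
    rw [← input_eq_inputForm hb]
    exact input_nonneg hb hWpos i hx
  exact
    { isCompact_stateSpace := hX ▸ isCompact_unitCube n
      interior_nonempty := hX ▸ interior_unitCube_nonempty n
      stateSpace_subset := hX ▸ hsub
      mapsTo_orthant := fun x hx => hsub (hupd x hx)
      mapsTo_stateSpace := by
        rw [hX]
        exact fun x hx => hupd x (hsub hx)
      piecewiseSmooth_update := by
        have : H.update = fun x => WithLp.toLp 2 fun i => H.activation i (H.inputForm i x) := by
          funext x
          simp only [update, input_eq_inputForm hb]
        rw [this]
        exact piecewiseSmoothOn_toLp hact himage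
      piecewiseSmooth_activation := fun i => (hact i).mono <| by
        rintro _ ⟨x, hx, rfl⟩
        exact input_nonneg hb hWpos i hx }

/-- On the segment `[0, 1] • v` the network acts as the contracted rotation. -/
lemma orbit_smul (hb : ∀ i, H.bias i = 0)
    (hWpos : ∀ i j, 0 < H.weight i j) (hv : IsPerronProbabilityVector H.weight v)
    (hf : ∀ i, ∀ x : ℝ, 0 ≤ x → H.activation i x =
      piecewiseAffineActivation (perronRoot H.weight) fibonacciDelta (v i) x)
    {t : ℝ} (ht : t ∈ Icc (0 : ℝ) 1) (k : ℕ) :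
    H.orbit (t • v) k = contractedRotation^[k] t • v := by
  have hstep : ∀ s ∈ Icc (0 : ℝ) 1, H.update (s • v) = contractedRotation s • v := by
    rintro s ⟨h0, h1⟩
    ext i
    have hin : H.input i (s • v) = s * (perronRoot H.weight * v i) := by
      rw [input, hb, sub_zero, ← hv.eigenvector, Finset.mul_sum]
      exact Finset.sum_congr rfl fun j _ => by simp; ring
    have hpos := hv.perronRoot_mul_pos hWpos i
    change H.activation i (H.input i (s • v)) = _
    rw [hin, hf i _ (mul_nonneg h0 hpos.le),
      piecewiseAffineActivation_mul (hv.perronRoot_pos hWpos i) (hv.pos hWpos i) h1]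
    simp
  induction k with
  | zero => rfl
  | succ k ih =>
    rw [orbit] at ih ⊢
    rw [Function.iterate_succ_apply', Function.iterate_succ_apply', ih,
      hstep _ (mapsTo_contractedRotation.iterate k ht)]

lemma isChaoticOn_smul_rotationAttractor
    (hX : H.stateSpace = unitCube n) (hb : ∀ i, H.bias i = 0)
    (hWpos : ∀ i j, 0 < H.weight i j) (hv : IsPerronProbabilityVector H.weight v)
    (hf : ∀ i, ∀ x : ℝ, 0 ≤ x → H.activation i x =
      piecewiseAffineActivation (perronRoot H.weight) fibonacciDelta (v i) x) :
    H.IsChaoticOn ((· • v) '' rotationAttractor) := by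
  have hnorm := hv.norm_pos
  have hemb : IsClosedEmbedding (· • v : ℝ → EuclideanSpace ℝ (Fin n)) :=
    isClosedEmbedding_smul_left (norm_pos_iff.1 hnorm)
  have hcpt := isCompact_rotationAttractor.image hemb.continuous
  have hcube : ∀ t ∈ Icc (0 : ℝ) 1, t • v ∈ H.stateSpace := by
    rintro t ⟨h0, h1⟩
    rw [hX]
    intro i
    simpa using ⟨mul_nonneg h0 (hv.nonneg i), mul_le_one₀ h1 (hv.nonneg i) (hv.le_one i)⟩
  refine ⟨⟨⟨_, mem_image_of_mem _ zero_mem_rotationAttractor⟩, hcpt, ⟨hcpt.isClosed, ?_⟩,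
    hemb.isEmbedding.isTotallyDisconnected_image.2 isTotallyDisconnected_rotationAttractor⟩,
    image_subset_iff.2 fun t ht => hcube t (rotationAttractor_subset ht), ?_, ?_⟩
  · rintro _ ⟨p, hp, rfl⟩
    simpa only [map_principal] using (preperfect_rotationAttractor p hp).map
      hemb.continuous.continuousAt hemb.injective
  · rintro _ ⟨x, hx, rfl⟩
    have hx1 := rotationAttractor_subset hx
    ext p
    simp only [omegaLimitSet, mem_ofPred_eq, orbit_smul hb hWpos hv hf hx1]
    constructor
    · rintro ⟨m, -, hm⟩
      exact hcpt.isClosed.mem_of_tendsto hm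
        (.of_forall fun k => mem_image_of_mem _ (iterate_mem_rotationAttractor hx _))
    · rintro ⟨q, hq, rfl⟩
      obtain ⟨m, hm, hlim⟩ := exists_subseq_tendsto hx hq
      exact ⟨m, hm, hlim.smul_const v⟩
  · rintro _ ⟨x, hx, rfl⟩
    have hx1 := rotationAttractor_subset hx
    refine ⟨1 / 2 * ‖v‖, by positivity, fun ε hε => ?_⟩
    obtain ⟨x', hx', hlt, k, hk⟩ := exists_half_le_iterate_sub hx (div_pos hε hnorm)
    refine ⟨x' • v, hcube x' hx', k, ?_, ?_⟩
    · rw [← sub_smul, norm_smul, Real.norm_eq_abs]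
      exact ((lt_div_iff₀ hnorm).1 hlt).le
    · simp only [orbit_smul hb hWpos hv hf hx1, orbit_smul hb hWpos hv hf hx']
      rw [← sub_smul, norm_smul, Real.norm_eq_abs]
      gcongr

end HopfieldData

theorem mainTheorem1 {n : ℕ} (H : HopfieldData n) (v : EuclideanSpace ℝ (Fin n))
    (hX : H.stateSpace = unitCube n) (hb : ∀ i, H.bias i = 0)
    (hWpos : ∀ i j, 0 < H.weight i j)
    (hWsum : ∀ i, 3 / 4 < ∑ j, H.weight i j ∧ ∑ j, H.weight i j < 1)
    (hv : IsPerronProbabilityVector H.weight v)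
    (hf : ∀ i, ∀ x : ℝ, 0 ≤ x → H.activation i x =
      piecewiseAffineActivation (perronRoot H.weight) fibonacciDelta (v i) x) :
    H.IsNetwork ∧
      ∃ C : Set (EuclideanSpace ℝ (Fin n)),
        H.IsChaoticOn C ∧ C ⊆ {x | ∃ t : ℝ, x = t • v} := by
  refine ⟨HopfieldData.isNetwork_of_piecewiseAffineActivation hX hb hWpos hv hf, _,
    HopfieldData.isChaoticOn_smul_rotationAttractor hX hb hWpos hv hf, ?_⟩
  rintro _ ⟨t, -, rfl⟩
  exact ⟨t, rfl⟩
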